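/- Let $\mathcal{X}\subseteq\mathbb{R}^{d_1}$ be bounded, let $\Theta\subset\mathbb{R}\times\mathbb{R}^{d_1}\times\mathbb{R}^{d_2}$ be compact, and let $\Theta_\eta$ be the set of all $\eta$ with $(\beta_0,\beta_1,\eta)\in\Theta$ for some $\beta_0,\beta_1$. Let $h(x,\eta)$ be a real-valued expert function which is measurable in $x$ for every $\eta\in\Theta_\eta$, is bounded on $\mathcal{X}\times\Theta_\eta$, and is Lipschitz in $\eta\in\Theta_\eta$ uniformly in $x\in\mathcal{X}$. For a mixing measure $G=\sum_{i=1}^{k}\exp(\beta_{0i})\delta_{(\beta_{1i},\eta_i)}$, $k\ge 1$, put $$f_G(x)=\sum_{i=1}^{k}\frac{\exp\Big(\frac{\beta_{1i}^\top x}{\|\beta_{1i}\|\,\|x\|}+\beta_{0i}\Big)}{\sum_{j=1}^{k}\exp\Big(\frac{\beta_{1j}^\top x}{\|\beta_{1j}\|\,\|x\|}+\beta_{0j}\Big)}\;h(x,\eta_i),$$ where the cosine is read as $0$ if one of the two vectors is zero. Let $\mathcal{E}_k(\Theta)$ be the set of all such $G$ with $(\beta_{0i},\beta_{1i},\eta_i)\in\Theta$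 for all $1\le i\le k$ (repetitions allowed), and $\mathcal{G}_k(\Theta)=\bigcup_{1\le k'\le k}\mathcal{E}_{k'}(\Theta)$. Let $k_*\ge1$, $G_*\in\mathcal{E}_{k_*}(\Theta)$, let $\mu$ be a probability measure on $\mathbb{R}^{d_1}$ concentrated on $\mathcal{X}$, and let $\sigma\ge 0$. Let $(X_i,\varepsilon_i)_{i\ge1}$ be i.i.d. such that $X_i\sim\mu$ and, conditionally on $X_i$, $\varepsilon_i\sim N(0,\sigma^2)$, and let $Y_i=f_{G_*}(X_i)+\varepsilon_i$. Let $\mathcal{G}$ be either $\mathcal{E}_{k_*}(\Theta)$ (exact-specified setting) or $\mathcal{G}_k(\Theta)$ for some $k>k_*$ (over-specified setting), and for every $n$ let $\widehat{G}_n$ be a least squares estimator over $\mathcal{G}$, that is, almost surely $$\widehat{G}_n\in\operatorname*{argmin}_{G\in\mathcal{G}}\sum_{i=1}^{n}\big(Y_i-f_G(X_i)\big)^2.$$ Then $$\|f_{\widehat{G}_n}-f_{G_*}\|_{L^2(\mu)}=\mathcal{O}_P\big(\sqrt{\log(n)/n}\big),$$ that is, for every $\delta>0$ there is $M>0$ such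 that for all $n\ge2$ the probability of $\|f_{\widehat{G}_n}-f_{G_*}\|_{L^2(\mu)}>M\sqrt{\log(n)/n}$ is at most $\delta$ (outer probability, if this event is not measurable). -/

import Mathlib

open MeasureTheory ProbabilityTheory
open scoped NNReal ENNReal

noncomputable section

/-- The Euclidean space `ℝᵈ`. -/
abbrev RVec (d : ℕ) : Type := EuclideanSpace ℝ (Fin d)

/-- The space `ℝ × ℝ^{d₁} × ℝ^{d₂}` of expert parameters `(β₀, β₁, η)`. -/
abbrev ExpertParam (d₁ d₂ : ℕ) : Type := ℝ × RVec d₁ × RVec d₂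

/-- The cosine score `βᵀx / (‖β‖ ‖x‖)`; it is read as `0` when `β = 0` or `x = 0`. -/
def cosScore {d : ℕ} (β x : RVec d) : ℝ := inner ℝ β x / (‖β‖ * ‖x‖)

/-- `Softmax(v_i) = exp(v_i) / ∑_j exp(v_j)`. -/
def softmaxWeight {k : ℕ} (v : Fin k → ℝ) (i : Fin k) : ℝ :=
  Real.exp (v i) / ∑ j, Real.exp (v j)

/-- The mixing measure `∑_i exp(β₀ᵢ) δ_{(β₁ᵢ, ηᵢ)}` of a finite family of parameters. -/
def mixingMeasure {d₁ d₂ k : ℕ} (θ : Fin k → ExpertParam d₁ d₂) :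
    Measure (RVec d₁ × RVec d₂) :=
  ∑ i, ENNReal.ofReal (Real.exp (θ i).1) • Measure.dirac (θ i).2

/-- `𝓔_k(Θ)`: the mixing measures of families of exactly `k` parameters in `Θ`. -/
def exactMixing {d₁ d₂ : ℕ} (Θ : Set (ExpertParam d₁ d₂)) (k : ℕ) :
    Set (Measure (RVec d₁ × RVec d₂)) :=
  {G | ∃ θ : Fin k → ExpertParam d₁ d₂, (∀ i, θ i ∈ Θ) ∧ G = mixingMeasure θ}

/-- `𝓖_k(Θ)`: the mixing measures of families of `k'` parameters in `Θ`, `1 ≤ k' ≤ k`. -/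
def overMixing {d₁ d₂ : ℕ} (Θ : Set (ExpertParam d₁ d₂)) (k : ℕ) :
    Set (Measure (RVec d₁ × RVec d₂)) :=
  {G | ∃ k' : ℕ, 1 ≤ k' ∧ k' ≤ k ∧ G ∈ exactMixing Θ k'}

/-- The cosine router mixture-of-experts regression function `f_G` of a mixing measure `G`.
Written with integrals, it depends on the measure only; on the mixing measure of a finite family it
is the softmax-weighted sum of experts, by `moeRegression_mixingMeasure`. -/
def moeRegression {d₁ d₂ : ℕ} (h : RVec d₁ → RVec d₂ → ℝ)
    (G : Measure (RVec d₁ × RVec d₂)) (x : RVec d₁) : ℝ :=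
  (∫ w, Real.exp (cosScore w.1 x) * h x w.2 ∂G) / ∫ w, Real.exp (cosScore w.1 x) ∂G

theorem integral_mixingMeasure {d₁ d₂ k : ℕ} (θ : Fin k → ExpertParam d₁ d₂)
    (F : RVec d₁ × RVec d₂ → ℝ) :
    ∫ w, F w ∂(mixingMeasure θ) = ∑ i, Real.exp (θ i).1 * F (θ i).2 := by
  unfold mixingMeasure
  rw [integral_finsetSum_measure]
  · refine Finset.sum_congr rfl fun i _ => ?_
    rw [integral_smul_measure, integral_dirac, ENNReal.toReal_ofReal (Real.exp_pos _).le,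
      smul_eq_mul]
  · intro i _
    exact (integrable_dirac (by simp)).smul_measure ENNReal.ofReal_ne_top

theorem moeRegression_mixingMeasure {d₁ d₂ k : ℕ} (h : RVec d₁ → RVec d₂ → ℝ)
    (θ : Fin k → ExpertParam d₁ d₂) (x : RVec d₁) :
    moeRegression h (mixingMeasure θ) x =
      ∑ i, softmaxWeight (fun j => cosScore (θ j).2.1 x + (θ j).1) i * h x (θ i).2.2 := by
  unfold moeRegression softmaxWeight
  rw [integral_mixingMeasure, integral_mixingMeasure, Finset.sum_div]
  have e : ∀ j, Real.exp (cosScore (θ j).2.1 x + (θ j).1)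
      = Real.exp (θ j).1 * Real.exp (cosScore (θ j).2.1 x) := fun j => by
    rw [Real.exp_add, mul_comm]
  simp only [e]
  exact Finset.sum_congr rfl fun i _ => by ring

/-- The least squares criterion `∑_{i < n} (y_i - f_G(x_i))²`. -/
def squaredLoss {d₁ d₂ : ℕ} (h : RVec d₁ → RVec d₂ → ℝ) (x : ℕ → RVec d₁) (y : ℕ → ℝ) (n : ℕ)
    (G : Measure (RVec d₁ × RVec d₂)) : ℝ :=
  ∑ i ∈ Finset.range n, (y i - moeRegression h G (x i)) ^ 2

/-- `Ghat` is a least squares estimator over the class `𝒢`, for the first `n` data points. -/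
def IsLeastSquares {d₁ d₂ : ℕ} (h : RVec d₁ → RVec d₂ → ℝ)
    (𝒢 : Set (Measure (RVec d₁ × RVec d₂))) (x : ℕ → RVec d₁) (y : ℕ → ℝ) (n : ℕ)
    (Ghat : Measure (RVec d₁ × RVec d₂)) : Prop :=
  Ghat ∈ 𝒢 ∧ ∀ G ∈ 𝒢, squaredLoss h x y n Ghat ≤ squaredLoss h x y n G

/-- `Z_n = O_P(r_n)`: the ratios `Z_n / r_n` (over all `n` with `r_n > 0`) are stochastically
bounded. If `Z_n` is not measurable, the probability is the outer one. -/
def IsBigOP {Ω : Type*} [MeasurableSpace Ω] (P : Measure Ω) (Z : ℕ → Ω → ℝ≥0∞) (r : ℕ → ℝ) :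
    Prop :=
  ∀ δ : ℝ, 0 < δ → ∃ M : ℝ, 0 < M ∧ ∀ n : ℕ, 0 < r n →
    P {ω | ENNReal.ofReal (M * r n) < Z n ω} ≤ ENNReal.ofReal δ

/-- The projection of `Θ` to the expert parameters `η`. -/
def expertParams {d₁ d₂ : ℕ} (Θ : Set (ExpertParam d₁ d₂)) : Set (RVec d₂) :=
  (fun θ => θ.2.2) '' Θ

end

/-! The minimizer `fhat` has empirical squared loss at most that of `fstar`, so the summed excess
loss of `D = fhat - fstar` is nonpositive. For one fixed bounded `D` this is unlikely unless `D` is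
small in `L²(μ)`: integrating out the Gaussian noise and then `x` gives `E exp(-l * excessLoss D) ≤
exp(-(l/4) ∫ D²)` for small `l` (`mgf_excessLoss_le`), and Chernoff's bound for the i.i.d. sum gives
probability at most `exp(l t - n (l/4) ∫ D²)` that the sum is at most `t`
(`measureReal_sum_excessLoss_le`).

To pass to the random `fhat`, replace it by a nearby member `g` of a `1/n`-cover of the class. Off
an event of small probability, controlled by Markov's inequality for `∑ |e i|`, this changes the
summed excess loss by a constant only, so a constant `t` suffices. If `fhat` is farther than `M r`
from `fstar`, with `r = √(log n / n)`, then `g` is at least `M r / 2` away, and each such `g`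
contributes at most a constant times `n ^ (-l M² / 16)`. For large `M` this beats the polynomial
size of the cover in a union bound (`isBigOP_leastSquares`).

The router enters only through the covers. The cosine score depends on `β₁` through its direction
alone and is linear in that direction. In normalized parameters, which form a bounded set, the
regression function is therefore Lipschitz uniformly in `x` (`abs_normalizedRegression_sub_le`), and
a grid gives polynomial covers. -/

/-! ### Polynomial covers -/

/-- A bounded subset of a finite-dimensional space has internal `1 / n`-covers whose size is
polynomial in `n`. -/
theorem exists_polynomial_cover_of_isBounded {V : Type*} [NormedAddCommGroup V] [NormedSpace ℝ V]
    [FiniteDimensional ℝ V] {A : Set V} (hA : Bornology.IsBounded A) :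
    ∃ C p : ℕ, ∀ n : ℕ, 1 ≤ n → ∃ T : Finset V, (T : Set V) ⊆ A ∧ T.card ≤ C * n ^ p ∧
      ∀ s ∈ A, ∃ t ∈ T, dist s t ≤ 1 / n := by
  classical
  let φ : V ≃L[ℝ] (Fin (Module.finrank ℝ V) → ℝ) :=
    ContinuousLinearEquiv.ofFinrankEq (by simp)
  obtain ⟨R, hR⟩ := hA.exists_norm_le
  obtain ⟨K, hK⟩ := exists_nat_ge ‖(φ.symm : (Fin (Module.finrank ℝ V) → ℝ) →L[ℝ] V)‖
  obtain ⟨r, hr⟩ := exists_nat_ge (K * (‖(φ : V →L[ℝ] (Fin (Module.finrank ℝ V) → ℝ))‖ * |R|))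
  refine ⟨(2 * r + 3) ^ Module.finrank ℝ V, Module.finrank ℝ V, fun n hn => ?_⟩
  have hn0 : (0 : ℝ) < n := by exact_mod_cast hn
  -- Grid of mesh `1 / (K n)` in coordinates: as `K` bounds the norm of `φ.symm`, points in one cell
  -- are within `1 / n` of each other.
  let cell : V → Fin (Module.finrank ℝ V) → ℤ := fun s i => ⌊K * n * φ s i⌋
  let cells : Finset (Fin (Module.finrank ℝ V) → ℤ) :=
    Fintype.piFinset fun _ => Finset.Icc (-(r * n + 1 : ℤ)) (r * n + 1)
  have hcell : ∀ s ∈ A, cell s ∈ cells := by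
    intro s hs
    rw [Fintype.mem_piFinset]
    intro i
    have h1 : |φ s i| ≤ ‖(φ : V →L[ℝ] (Fin (Module.finrank ℝ V) → ℝ))‖ * |R| := by
      calc |φ s i| ≤ ‖φ s‖ := norm_le_pi_norm (φ s) i
        _ ≤ _ := (φ : V →L[ℝ] (Fin (Module.finrank ℝ V) → ℝ)).le_opNorm s
        _ ≤ _ := by
          gcongr
          exact (hR s hs).trans (le_abs_self R)
    have h2 : |K * n * φ s i| ≤ r * n := by
      rw [abs_mul, abs_of_nonneg (by positivity : (0 : ℝ) ≤ K * n)]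
      calc K * n * |φ s i| = (K * |φ s i|) * n := by ring
        _ ≤ (K * (‖(φ : V →L[ℝ] (Fin (Module.finrank ℝ V) → ℝ))‖ * |R|)) * n := by gcongr
        _ ≤ r * n := by gcongr
    obtain ⟨h3, h4⟩ := abs_le.1 h2
    rw [Finset.mem_Icc]
    constructor
    · rw [Int.le_floor]
      push_cast
      linarith
    · rw [← Int.cast_le (R := ℝ)]
      refine (Int.floor_le _).trans ?_
      push_cast
      linarith
  have hdist : ∀ s t, cell s = cell t → dist s t ≤ 1 / n := by
    intro s t hst
    -- If `K = 0`, then `φ.symm` vanishes, so all distances are zero.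
    rcases Nat.eq_zero_or_pos K with hK0 | hK0
    · have : dist s t ≤ 0 := by
        rw [dist_eq_norm, ← φ.symm_apply_apply (s - t)]
        refine ((φ.symm : (Fin (Module.finrank ℝ V) → ℝ) →L[ℝ] V).le_opNorm _).trans ?_
        refine mul_nonpos_of_nonpos_of_nonneg (hK.trans ?_) (norm_nonneg _)
        simp [hK0]
      exact this.trans (by positivity)
    have hK0' : (0 : ℝ) < K := by exact_mod_cast hK0
    have h1 : ‖φ (s - t)‖ ≤ 1 / (K * n) := by
      rw [pi_norm_le_iff_of_nonneg (by positivity)]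
      intro i
      have := Int.abs_sub_lt_one_of_floor_eq_floor (congrFun hst i)
      rw [← mul_sub, abs_mul, abs_of_pos (by positivity)] at this
      rw [map_sub, Pi.sub_apply, Real.norm_eq_abs, le_div_iff₀ (by positivity), mul_comm]
      exact this.le
    rw [dist_eq_norm, ← φ.symm_apply_apply (s - t)]
    calc _ ≤ ‖(φ.symm : (Fin (Module.finrank ℝ V) → ℝ) →L[ℝ] V)‖ * ‖φ (s - t)‖ :=
          (φ.symm : (Fin (Module.finrank ℝ V) → ℝ) →L[ℝ] V).le_opNorm _
      _ ≤ K * (1 / (K * n)) := by gcongr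
      _ = 1 / n := by field_simp
  have hrep : ∀ c ∈ cells.filter (fun c => ∃ s ∈ A, cell s = c), ∃ s, s ∈ A ∧ cell s = c :=
    fun c hc => (Finset.mem_filter.1 hc).2
  -- Representatives are taken in `A` itself, which makes the cover internal.
  choose! rep hrepA hrepc using hrep
  refine ⟨(cells.filter (fun c => ∃ s ∈ A, cell s = c)).image rep, ?_, ?_, fun s hs => ?_⟩
  · intro t ht
    obtain ⟨c, hc, rfl⟩ := Finset.mem_image.1 (Finset.mem_coe.1 ht)
    exact hrepA c hc
  · refine Finset.card_image_le.trans ((Finset.card_filter_le _ _).trans ?_)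
    rw [Fintype.card_piFinset_const, ← mul_pow]
    simp only [Int.card_Icc]
    gcongr
    have : (r * n + 1 + 1 - -(r * n + 1 : ℤ)).toNat = 2 * (r * n) + 3 := by
      have : (r * n + 1 + 1 - -(r * n + 1 : ℤ)) = ((2 * (r * n) + 3 : ℕ) : ℤ) := by
        push_cast
        ring
      rw [this, Int.toNat_natCast]
    rw [this]
    nlinarith
  · have hc : cell s ∈ cells.filter (fun c => ∃ s ∈ A, cell s = c) :=
      Finset.mem_filter.2 ⟨hcell s hs, s, hs, rfl⟩
    exact ⟨_, Finset.mem_image_of_mem _ hc, hdist _ _ (hrepc _ hc).symm⟩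

/-- A class of real functions has finite internal covers in the uniform distance on `𝒳`, of radius
`1 / n` and size polynomial in `n`. -/
def HasPolynomialUniformCovers {E : Type*} (𝒳 : Set E) (𝓕 : Set (E → ℝ)) : Prop :=
  ∃ C p : ℕ, ∀ n : ℕ, 1 ≤ n → ∃ T : Finset (E → ℝ), (T : Set (E → ℝ)) ⊆ 𝓕 ∧
    T.card ≤ C * n ^ p ∧ ∀ f ∈ 𝓕, ∃ g ∈ T, ∀ x ∈ 𝒳, |f x - g x| ≤ 1 / n

theorem HasPolynomialUniformCovers.empty {E : Type*} (𝒳 : Set E) :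
    HasPolynomialUniformCovers 𝒳 (∅ : Set (E → ℝ)) :=
  ⟨0, 0, fun _ _ => ⟨∅, by simp, by simp, by simp⟩⟩

theorem HasPolynomialUniformCovers.union {E : Type*} {𝒳 : Set E} {𝓕 𝓗 : Set (E → ℝ)}
    (hF : HasPolynomialUniformCovers 𝒳 𝓕) (hH : HasPolynomialUniformCovers 𝒳 𝓗) :
    HasPolynomialUniformCovers 𝒳 (𝓕 ∪ 𝓗) := by
  classical
  obtain ⟨C, p, hF⟩ := hF
  obtain ⟨D, q, hH⟩ := hH
  refine ⟨C + D, p + q, fun n hn => ?_⟩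
  obtain ⟨S, hSF, hSc, hS⟩ := hF n hn
  obtain ⟨T, hTH, hTc, hT⟩ := hH n hn
  refine ⟨S ∪ T, ?_, ?_, ?_⟩
  · rw [Finset.coe_union]
    exact Set.union_subset_union hSF hTH
  · calc (S ∪ T).card ≤ S.card + T.card := Finset.card_union_le _ _
      _ ≤ C * n ^ p + D * n ^ q := add_le_add hSc hTc
      _ ≤ C * n ^ (p + q) + D * n ^ (p + q) := by
        gcongr <;> omega
      _ = _ := by ring
  · rintro f (hf | hf)
    · obtain ⟨g, hg, h⟩ := hS f hf
      exact ⟨g, Finset.mem_union_left _ hg, h⟩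
    · obtain ⟨g, hg, h⟩ := hT f hf
      exact ⟨g, Finset.mem_union_right _ hg, h⟩

/-- A class that is parametrized by a bounded subset of a finite-dimensional space, in a Lipschitz
way for the uniform distance on `𝒳`, has polynomial uniform covers. -/
theorem HasPolynomialUniformCovers.image {E V : Type*} [NormedAddCommGroup V] [NormedSpace ℝ V]
    [FiniteDimensional ℝ V] {A : Set V} (hA : Bornology.IsBounded A) {𝒳 : Set E} (Φ : V → E → ℝ)
    (L : ℝ) (hΦ : ∀ s ∈ A, ∀ t ∈ A, ∀ x ∈ 𝒳, |Φ s x - Φ t x| ≤ L * dist s t) :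
    HasPolynomialUniformCovers 𝒳 (Φ '' A) := by
  classical
  obtain ⟨C, p, hC⟩ := exists_polynomial_cover_of_isBounded hA
  obtain ⟨m, hm⟩ := exists_nat_ge L
  refine ⟨C * (m + 1) ^ p, p, fun n hn => ?_⟩
  have hn0 : (0 : ℝ) < n := by exact_mod_cast hn
  -- The finer scale `1 / ((m + 1) n)` absorbs the Lipschitz constant; `m + 1` keeps the scale
  -- positive when `m = 0`.
  obtain ⟨T, hTA, hTc, hT⟩ := hC ((m + 1) * n) (Nat.mul_pos m.succ_pos hn)
  refine ⟨T.image Φ, ?_, ?_, ?_⟩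
  · rw [Finset.coe_image]
    exact Set.image_mono hTA
  · refine Finset.card_image_le.trans (hTc.trans (le_of_eq ?_))
    rw [mul_pow, mul_assoc]
  · rintro _ ⟨s, hs, rfl⟩
    obtain ⟨t, ht, hst⟩ := hT s hs
    refine ⟨_, Finset.mem_image_of_mem _ ht, fun x hx => ?_⟩
    calc |Φ s x - Φ t x| ≤ L * dist s t := hΦ s hs t (hTA ht) x hx
      _ ≤ (m + 1) * dist s t := by
        gcongr
        linarith
      _ ≤ (m + 1) * (1 / ((m + 1 : ℕ) * n : ℕ)) := by gcongr
      _ = 1 / n := by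
        push_cast
        field_simp

/-! ### Stability of softmax averages -/

theorem softmaxWeight_nonneg {k : ℕ} (v : Fin k → ℝ) (i : Fin k) : 0 ≤ softmaxWeight v i :=
  div_nonneg (Real.exp_pos _).le (Finset.sum_nonneg fun _ _ => (Real.exp_pos _).le)

theorem sum_softmaxWeight_le_one {k : ℕ} (v : Fin k → ℝ) : ∑ i, softmaxWeight v i ≤ 1 := by
  unfold softmaxWeight
  rw [← Finset.sum_div]
  -- An inequality only, because for `k = 0` the quotient is `0 / 0 = 0`.
  exact div_self_le_one _

/-- Numerator and denominator each change by a factor of at most `exp ε`. -/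
theorem softmaxWeight_le_exp_mul {k : ℕ} {v w : Fin k → ℝ} {ε : ℝ} (hvw : ∀ i, |v i - w i| ≤ ε)
    (i : Fin k) : softmaxWeight v i ≤ Real.exp (2 * ε) * softmaxWeight w i := by
  have hpos : ∀ u : Fin k → ℝ, 0 < ∑ j, Real.exp (u j) := fun u =>
    Finset.sum_pos (fun _ _ => Real.exp_pos _) ⟨i, Finset.mem_univ i⟩
  have hsum : ∑ j, Real.exp (w j) ≤ Real.exp ε * ∑ j, Real.exp (v j) := by
    rw [Finset.mul_sum]
    refine Finset.sum_le_sum fun j _ => ?_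
    rw [← Real.exp_add, Real.exp_le_exp]
    linarith [(abs_le.1 (hvw j)).1]
  have hi : Real.exp (v i) ≤ Real.exp ε * Real.exp (w i) := by
    rw [← Real.exp_add, Real.exp_le_exp]
    linarith [(abs_le.1 (hvw i)).2]
  unfold softmaxWeight
  rw [mul_div_assoc', div_le_div_iff₀ (hpos v) (hpos w)]
  calc Real.exp (v i) * ∑ j, Real.exp (w j)
      ≤ (Real.exp ε * Real.exp (w i)) * (Real.exp ε * ∑ j, Real.exp (v j)) :=
        mul_le_mul hi hsum (hpos w).le (by positivity)
    _ = Real.exp (2 * ε) * Real.exp (w i) * ∑ j, Real.exp (v j) := by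
      rw [two_mul, Real.exp_add]
      ring

/-- The multiplicative comparison sums against weights of total mass at most one, so the constant
does not depend on `k`. For `2 * ε > 1` the trivial bound `2` is enough. -/
theorem sum_abs_softmaxWeight_sub_le {k : ℕ} {v w : Fin k → ℝ} {ε : ℝ} (hε : 0 ≤ ε)
    (hvw : ∀ i, |v i - w i| ≤ ε) : ∑ i, |softmaxWeight v i - softmaxWeight w i| ≤ 4 * ε := by
  rcases le_or_gt (2 * ε) 1 with h | h
  · have hexp : Real.exp (2 * ε) - 1 ≤ 4 * ε := by
      have := Real.abs_exp_sub_one_le (x := 2 * ε) (by rwa [abs_of_nonneg (by positivity)])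
      rw [abs_of_nonneg (by positivity : 0 ≤ 2 * ε)] at this
      linarith [le_abs_self (Real.exp (2 * ε) - 1)]
    have h1 : (1 : ℝ) ≤ Real.exp (2 * ε) := Real.one_le_exp (by positivity)
    have hi : ∀ i, |softmaxWeight v i - softmaxWeight w i| ≤ 4 * ε * softmaxWeight w i := by
      intro i
      have hv := softmaxWeight_le_exp_mul hvw i
      have hw := softmaxWeight_le_exp_mul (fun j => (abs_sub_comm (w j) (v j)).trans_le (hvw j)) i
      have hv0 := softmaxWeight_nonneg v i
      have hw0 := softmaxWeight_nonneg w i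
      rw [abs_le]
      constructor
      · rcases le_total (softmaxWeight v i) (softmaxWeight w i) with hle | hle
        · nlinarith
        · nlinarith
      · nlinarith
    calc ∑ i, |softmaxWeight v i - softmaxWeight w i| ≤ ∑ i, 4 * ε * softmaxWeight w i :=
          Finset.sum_le_sum fun i _ => hi i
      _ = 4 * ε * ∑ i, softmaxWeight w i := by rw [Finset.mul_sum]
      _ ≤ 4 * ε * 1 := by
        gcongr
        exact sum_softmaxWeight_le_one w
      _ = 4 * ε := mul_one _
  · calc ∑ i, |softmaxWeight v i - softmaxWeight w i|
        ≤ ∑ i, (softmaxWeight v i + softmaxWeight w i) := Finset.sum_le_sum fun i _ =>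
          (abs_sub _ _).trans_eq (by
            rw [abs_of_nonneg (softmaxWeight_nonneg v i), abs_of_nonneg (softmaxWeight_nonneg w i)])
      _ = ∑ i, softmaxWeight v i + ∑ i, softmaxWeight w i := Finset.sum_add_distrib
      _ ≤ 4 * ε := by linarith [sum_softmaxWeight_le_one v, sum_softmaxWeight_le_one w]

theorem abs_sum_softmaxWeight_mul_le {k : ℕ} (v : Fin k → ℝ) {a : Fin k → ℝ} {B : ℝ} (hB : 0 ≤ B)
    (ha : ∀ i, |a i| ≤ B) : |∑ i, softmaxWeight v i * a i| ≤ B :=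
  calc |∑ i, softmaxWeight v i * a i| ≤ ∑ i, |softmaxWeight v i * a i| :=
        Finset.abs_sum_le_sum_abs _ _
    _ ≤ ∑ i, softmaxWeight v i * B := Finset.sum_le_sum fun i _ => by
        rw [abs_mul, abs_of_nonneg (softmaxWeight_nonneg v i)]
        exact mul_le_mul_of_nonneg_left (ha i) (softmaxWeight_nonneg v i)
    _ = (∑ i, softmaxWeight v i) * B := by rw [Finset.sum_mul]
    _ ≤ 1 * B := by
        gcongr
        exact sum_softmaxWeight_le_one v
    _ = B := one_mul B

theorem abs_sum_softmaxWeight_mul_sub_le {k : ℕ} {v w a c : Fin k → ℝ} {B ε δ : ℝ} (hB : 0 ≤ B)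
    (hε : 0 ≤ ε) (hδ : 0 ≤ δ) (hvw : ∀ i, |v i - w i| ≤ ε) (hac : ∀ i, |a i - c i| ≤ δ)
    (hc : ∀ i, |c i| ≤ B) :
    |∑ i, softmaxWeight v i * a i - ∑ i, softmaxWeight w i * c i| ≤ δ + 4 * ε * B := by
  have e : ∑ i, softmaxWeight v i * a i - ∑ i, softmaxWeight w i * c i
      = ∑ i, softmaxWeight v i * (a i - c i)
        + ∑ i, (softmaxWeight v i - softmaxWeight w i) * c i := by
    rw [← Finset.sum_sub_distrib, ← Finset.sum_add_distrib]
    exact Finset.sum_congr rfl fun i _ => by ring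
  rw [e]
  refine (abs_add_le _ _).trans (add_le_add (abs_sum_softmaxWeight_mul_le v hδ hac) ?_)
  calc |∑ i, (softmaxWeight v i - softmaxWeight w i) * c i|
      ≤ ∑ i, |(softmaxWeight v i - softmaxWeight w i) * c i| := Finset.abs_sum_le_sum_abs _ _
    _ ≤ ∑ i, |softmaxWeight v i - softmaxWeight w i| * B := Finset.sum_le_sum fun i _ => by
        rw [abs_mul]
        exact mul_le_mul_of_nonneg_left (hc i) (abs_nonneg _)
    _ = (∑ i, |softmaxWeight v i - softmaxWeight w i|) * B := by rw [Finset.sum_mul]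
    _ ≤ 4 * ε * B := by
        gcongr
        exact sum_abs_softmaxWeight_sub_le hε hvw

/-! ### Exponential moments of the excess loss -/

theorem Real.exp_neg_le_one_sub_half {t : ℝ} (h0 : 0 ≤ t) (h1 : t ≤ 1) :
    Real.exp (-t) ≤ 1 - t / 2 := by
  rw [Real.exp_neg]
  refine inv_le_of_inv_le₀ (by linarith) ?_
  rw [inv_le_iff_one_le_mul₀ (by linarith)]
  nlinarith [Real.add_one_le_exp t]

section ExcessLoss

variable {E : Type*} {D : E → ℝ} {b l : ℝ} {v : ℝ≥0}

/-- The excess squared loss `(y - g x)² - (y - f x)²` at `y = f x + e`, in terms of `D = g - f`. -/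
def excessLoss (D : E → ℝ) (p : E × ℝ) : ℝ := D p.1 ^ 2 - 2 * p.2 * D p.1

theorem exp_neg_mul_excessLoss (x : E) (e : ℝ) :
    Real.exp (-l * excessLoss D (x, e)) =
      Real.exp (-l * D x ^ 2) * Real.exp (2 * l * D x * e) := by
  rw [← Real.exp_add]
  congr 1
  unfold excessLoss
  ring

theorem integral_exp_neg_mul_excessLoss (x : E) :
    ∫ e, Real.exp (-l * excessLoss D (x, e)) ∂(gaussianReal 0 v) =
      Real.exp (-l * D x ^ 2 + v * (2 * l * D x) ^ 2 / 2) := by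
  simp only [exp_neg_mul_excessLoss]
  rw [integral_const_mul, Real.exp_add]
  congr 1
  have := congrFun (mgf_fun_id_gaussianReal (μ := 0) (v := v)) (2 * l * D x)
  simpa [mgf] using this

/-- The Gaussian moment adds `2 l² v D²` to the exponent `-l D²`. By `hlv` this costs at most half
of the latter, and `hlb` puts the remainder in the range where `exp (-s) ≤ 1 - s / 2`. -/
theorem integral_exp_neg_mul_excessLoss_le (hl : 0 ≤ l) (hlv : l * v ≤ 1 / 4)
    (hlb : l / 2 * b ^ 2 ≤ 1) {x : E} (hx : |D x| ≤ b) :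
    ∫ e, Real.exp (-l * excessLoss D (x, e)) ∂(gaussianReal 0 v) ≤ 1 - l / 4 * D x ^ 2 := by
  rw [integral_exp_neg_mul_excessLoss]
  have hD : D x ^ 2 ≤ b ^ 2 := sq_le_sq' (abs_le.1 hx).1 (abs_le.1 hx).2
  have h2 : l * v * (l * D x ^ 2) ≤ 1 / 4 * (l * D x ^ 2) := by gcongr
  calc Real.exp (-l * D x ^ 2 + v * (2 * l * D x) ^ 2 / 2)
      ≤ Real.exp (-(l / 2 * D x ^ 2)) := by
        rw [Real.exp_le_exp]
        nlinarith
    _ ≤ 1 - l / 2 * D x ^ 2 / 2 := Real.exp_neg_le_one_sub_half (by positivity)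
        (le_trans (by gcongr) hlb)
    _ = _ := by ring

variable [MeasurableSpace E] {μ : Measure E}

theorem measurable_excessLoss (hD : Measurable D) : Measurable (excessLoss D) := by
  unfold excessLoss
  fun_prop

variable [IsProbabilityMeasure μ]

theorem integrable_exp_neg_mul_excessLoss (hD : Measurable D) (hb : ∀ᵐ x ∂μ, |D x| ≤ b)
    (hl : 0 ≤ l) (hlv : l * v ≤ 1 / 4) (hlb : l / 2 * b ^ 2 ≤ 1) :
    Integrable (fun p => Real.exp (-l * excessLoss D p)) (μ.prod (gaussianReal 0 v)) := by
  have hmeas : Measurable (fun p => Real.exp (-l * excessLoss D p)) :=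
    ((measurable_excessLoss hD).const_mul _).exp
  rw [integrable_prod_iff hmeas.aestronglyMeasurable]
  refine ⟨ae_of_all _ fun x => ?_, ?_⟩
  · simp only [exp_neg_mul_excessLoss]
    exact (integrable_exp_mul_gaussianReal _).const_mul _
  · simp only [Real.norm_eq_abs, Real.abs_exp]
    refine Integrable.of_bound (C := 1) ?_ ?_
    · simp only [integral_exp_neg_mul_excessLoss]
      exact Measurable.aestronglyMeasurable (by fun_prop)
    · filter_upwards [hb] with x hx
      rw [Real.norm_of_nonneg (integral_nonneg fun _ => (Real.exp_pos _).le)]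
      refine (integral_exp_neg_mul_excessLoss_le hl hlv hlb hx).trans ?_
      nlinarith [mul_nonneg hl (sq_nonneg (D x))]

theorem mgf_excessLoss_le (hD : Measurable D) (hb : ∀ᵐ x ∂μ, |D x| ≤ b)
    (hl : 0 ≤ l) (hlv : l * v ≤ 1 / 4) (hlb : l / 2 * b ^ 2 ≤ 1) :
    mgf (excessLoss D) (μ.prod (gaussianReal 0 v)) (-l) ≤
      Real.exp (-(l / 4 * ∫ x, D x ^ 2 ∂μ)) := by
  have hint := integrable_exp_neg_mul_excessLoss hD hb hl hlv hlb
  have hD2 : Integrable (fun x => D x ^ 2) μ := by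
    refine Integrable.of_bound (C := b ^ 2) (hD.pow_const 2).aestronglyMeasurable ?_
    filter_upwards [hb] with x hx
    rw [Real.norm_of_nonneg (sq_nonneg _)]
    exact sq_le_sq' (abs_le.1 hx).1 (abs_le.1 hx).2
  unfold mgf
  rw [integral_prod _ hint]
  calc ∫ x, ∫ e, Real.exp (-l * excessLoss D (x, e)) ∂(gaussianReal 0 v) ∂μ
      ≤ ∫ x, (1 - l / 4 * D x ^ 2) ∂μ := by
        refine integral_mono_ae hint.integral_prod_left
          ((integrable_const _).sub (hD2.const_mul _)) ?_
        filter_upwards [hb] with x hx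
        exact integral_exp_neg_mul_excessLoss_le hl hlv hlb hx
    _ = 1 - l / 4 * ∫ x, D x ^ 2 ∂μ := by
        rw [integral_sub (integrable_const _) (hD2.const_mul _), integral_const_mul]
        simp
    _ ≤ _ := by
        have := Real.add_one_le_exp (-(l / 4 * ∫ x, D x ^ 2 ∂μ))
        linarith

/-- The empirical excess loss of a fixed function is unlikely to be small. -/
theorem measureReal_sum_excessLoss_le {Ω : Type*} [MeasurableSpace Ω] {P : Measure Ω}
    [IsProbabilityMeasure P] {Z : ℕ → Ω → E × ℝ} (hZ : ∀ i, Measurable (Z i))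
    (h_indep : iIndepFun Z P) (h_law : ∀ i, P.map (Z i) = μ.prod (gaussianReal 0 v))
    (hD : Measurable D) (hb : ∀ᵐ x ∂μ, |D x| ≤ b)
    (hl : 0 ≤ l) (hlv : l * v ≤ 1 / 4) (hlb : l / 2 * b ^ 2 ≤ 1) (n : ℕ) (t : ℝ) :
    P.real {ω | ∑ i ∈ Finset.range n, excessLoss D (Z i ω) ≤ t} ≤
      Real.exp (l * t - n * (l / 4 * ∫ x, D x ^ 2 ∂μ)) := by
  have hφ := measurable_excessLoss hD
  have hind : iIndepFun (fun i => excessLoss D ∘ Z i) P := h_indep.comp _ fun _ => hφ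
  have hm : ∀ i, Measurable (excessLoss D ∘ Z i) := fun i => hφ.comp (hZ i)
  have hint : ∀ i, Integrable (fun ω => Real.exp (-l * (excessLoss D ∘ Z i) ω)) P := by
    intro i
    have := integrable_exp_neg_mul_excessLoss hD hb hl hlv hlb
    rw [← h_law i] at this
    exact this.comp_measurable (hZ i)
  have hmgf : ∀ i, mgf (excessLoss D ∘ Z i) P (-l) ≤ Real.exp (-(l / 4 * ∫ x, D x ^ 2 ∂μ)) := by
    intro i
    rw [← mgf_map (hZ i).aemeasurable, h_law i]
    · exact mgf_excessLoss_le hD hb hl hlv hlb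
    · exact (((measurable_excessLoss hD).const_mul _).exp).aestronglyMeasurable
  have key := measure_le_le_exp_mul_mgf (μ := P)
    (X := ∑ i ∈ Finset.range n, excessLoss D ∘ Z i) t (neg_nonpos.2 hl)
    (hind.integrable_exp_mul_sum hm fun i _ => hint i)
  rw [hind.mgf_sum hm] at key
  simp only [Finset.sum_apply, Function.comp_apply, neg_neg] at key
  refine key.trans ?_
  rw [sub_eq_add_neg, Real.exp_add]
  gcongr
  calc ∏ i ∈ Finset.range n, mgf (excessLoss D ∘ Z i) P (-l)
      ≤ ∏ _i ∈ Finset.range n, Real.exp (-(l / 4 * ∫ x, D x ^ 2 ∂μ)) :=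
        Finset.prod_le_prod (fun _ _ => mgf_nonneg) fun i _ => hmgf i
    _ = _ := by
        rw [Finset.prod_const, Finset.card_range, ← Real.exp_nat_mul]
        ring_nf

end ExcessLoss

/-! ### Rate of least squares over a covered class -/

theorem eLpNorm_two_eq_ofReal_sqrt {E : Type*} [MeasurableSpace E] {μ : Measure E} {f : E → ℝ}
    (hf : MemLp f 2 μ) : eLpNorm f 2 μ = ENNReal.ofReal (Real.sqrt (∫ x, f x ^ 2 ∂μ)) := by
  rw [hf.eLpNorm_eq_integral_rpow_norm (by simp) (by simp), Real.sqrt_eq_rpow]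
  simp

/-- Markov's inequality for the absolute noise. -/
theorem measureReal_sum_abs_ge_le {Ω : Type*} [MeasurableSpace Ω] {P : Measure Ω}
    [IsProbabilityMeasure P] {ξ : ℕ → Ω → ℝ} {κ : ℝ} (hint : ∀ i, Integrable (ξ i) P)
    (hκ : ∀ i, ∫ ω, |ξ i ω| ∂P = κ) {n : ℕ} (hn : 1 ≤ n) {K δ : ℝ} (hK : 0 < K)
    (hKδ : κ ≤ K * δ) :
    P.real {ω | K * n ≤ ∑ i ∈ Finset.range n, |ξ i ω|} ≤ δ := by
  have hn0 : (0 : ℝ) < n := by exact_mod_cast hn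
  have h := mul_meas_ge_le_integral_of_nonneg (μ := P)
    (f := fun ω => ∑ i ∈ Finset.range n, |ξ i ω|)
    (ae_of_all _ fun ω => Finset.sum_nonneg fun i _ => abs_nonneg _)
    (integrable_finsetSum _ fun i _ => (hint i).abs) (K * n)
  rw [integral_finsetSum _ fun i _ => (hint i).abs] at h
  simp only [hκ, Finset.sum_const, Finset.card_range, nsmul_eq_mul] at h
  have h2 : K * n * P.real {ω | K * n ≤ ∑ i ∈ Finset.range n, |ξ i ω|} ≤ K * n * δ := by
    refine h.trans ?_
    calc n * κ ≤ n * (K * δ) := by gcongr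
      _ = K * n * δ := by ring
  exact le_of_mul_le_mul_left h2 (by positivity)

theorem exists_rate_constant (A p l : ℝ) {δ : ℝ} (hp : 0 ≤ p) (hl : 0 < l) (hδ : 0 < δ) :
    ∃ M : ℝ, 2 ≤ M ∧ ∀ n : ℕ, 2 ≤ n →
      A * (n : ℝ) ^ p * Real.exp (-(l * M ^ 2 * Real.log n)) ≤ δ := by
  obtain ⟨Q, hQ0, hQ⟩ : ∃ Q : ℝ, 0 ≤ Q ∧ |A| * Real.exp (-(Q * Real.log 2)) ≤ δ := by
    have hlog := Real.log_pos one_lt_two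
    -- With this `Q` the exponent is `-|A| / δ`, and `exp s ≥ s` suffices.
    refine ⟨|A| / δ / Real.log 2, by positivity, ?_⟩
    rw [div_mul_cancel₀ _ hlog.ne', Real.exp_neg, ← div_eq_mul_inv, div_le_iff₀ (Real.exp_pos _)]
    have := Real.add_one_le_exp (|A| / δ)
    calc |A| = δ * (|A| / δ) := by field_simp
      _ ≤ δ * Real.exp (|A| / δ) := by
        gcongr
        linarith
  -- Since `(2 + a)² ≥ a`, `l M² ≥ p + Q`: the part `p` cancels `n ^ p` and the part `Q` absorbs
  -- `A`.
  refine ⟨2 + (p + Q) / l, by linarith [show 0 ≤ (p + Q) / l by positivity], fun n hn => ?_⟩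
  have hn2 : (2 : ℝ) ≤ n := by exact_mod_cast hn
  have hlog : Real.log 2 ≤ Real.log n := Real.log_le_log two_pos hn2
  have hlog2 := Real.log_pos one_lt_two
  have ha : 0 ≤ (p + Q) / l := by positivity
  have hM : p + Q ≤ l * (2 + (p + Q) / l) ^ 2 := by
    have : p + Q = l * ((p + Q) / l) := by field_simp
    calc p + Q = l * ((p + Q) / l) := this
      _ ≤ l * (2 + (p + Q) / l) ^ 2 := by
        gcongr
        nlinarith
  calc A * (n : ℝ) ^ p * Real.exp (-(l * (2 + (p + Q) / l) ^ 2 * Real.log n))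
      ≤ |A| * (n : ℝ) ^ p * Real.exp (-((p + Q) * Real.log n)) := by
        gcongr
        exact le_abs_self A
    _ = |A| * Real.exp (-(Q * Real.log n)) := by
        rw [Real.rpow_def_of_pos (by linarith), mul_assoc, ← Real.exp_add]
        ring_nf
    _ ≤ |A| * Real.exp (-(Q * Real.log 2)) := by gcongr
    _ ≤ δ := hQ

theorem sum_excessLoss_nonpos_of_sum_sq_le {E : Type*} {f g : E → ℝ} {x : ℕ → E} {y e : ℕ → ℝ}
    {n : ℕ} (hy : ∀ i, y i = f (x i) + e i)
    (h : ∑ i ∈ Finset.range n, (y i - g (x i)) ^ 2 ≤ ∑ i ∈ Finset.range n, (y i - f (x i)) ^ 2) :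
    ∑ i ∈ Finset.range n, excessLoss (fun z => g z - f z) (x i, e i) ≤ 0 := by
  rw [← sub_nonpos, ← Finset.sum_sub_distrib] at h
  refine (Finset.sum_congr rfl fun i _ => ?_).trans_le h
  rw [hy]
  unfold excessLoss
  ring

/-- The difference of the two losses factors as `(D' - D) (D' + D - 2 e)`, at most `(2 b + 2 |e|) /
n` per observation; the sum over `n` observations stays bounded. -/
theorem sum_excessLoss_le_of_uniform_close {E : Type*} {D D' : E → ℝ} {x : ℕ → E} {e : ℕ → ℝ}
    {n : ℕ} (hn : 1 ≤ n) {b K : ℝ} (hD : ∀ i, |D (x i)| ≤ b) (hD' : ∀ i, |D' (x i)| ≤ b)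
    (hDD' : ∀ i, |D (x i) - D' (x i)| ≤ 1 / n)
    (he : ∑ i ∈ Finset.range n, |e i| ≤ K * n)
    (h : ∑ i ∈ Finset.range n, excessLoss D (x i, e i) ≤ 0) :
    ∑ i ∈ Finset.range n, excessLoss D' (x i, e i) ≤ 2 * b + 2 * K := by
  have hn0 : (0 : ℝ) < n := by exact_mod_cast hn
  have hi : ∀ i, excessLoss D' (x i, e i) ≤
      excessLoss D (x i, e i) + (2 * b * (1 / n) + 2 * (1 / n) * |e i|) := by
    intro i
    have h1 : |(D' (x i) - D (x i)) * (D' (x i) + D (x i) - 2 * e i)| ≤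
        1 / n * (2 * b + 2 * |e i|) := by
      rw [abs_mul, abs_sub_comm]
      gcongr
      · exact hDD' i
      · calc |D' (x i) + D (x i) - 2 * e i| ≤ |D' (x i) + D (x i)| + |2 * e i| := abs_sub _ _
          _ ≤ (|D' (x i)| + |D (x i)|) + 2 * |e i| := by
            rw [abs_mul, abs_two]
            gcongr
            exact abs_add_le _ _
          _ ≤ 2 * b + 2 * |e i| := by linarith [hD i, hD' i]
    have h2 : excessLoss D' (x i, e i) - excessLoss D (x i, e i) =
        (D' (x i) - D (x i)) * (D' (x i) + D (x i) - 2 * e i) := by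
      unfold excessLoss
      ring
    have h3 := (le_abs_self _).trans h1
    rw [← h2] at h3
    linarith
  calc ∑ i ∈ Finset.range n, excessLoss D' (x i, e i)
      ≤ ∑ i ∈ Finset.range n,
          (excessLoss D (x i, e i) + (2 * b * (1 / n) + 2 * (1 / n) * |e i|)) :=
        Finset.sum_le_sum fun i _ => hi i
    _ = ∑ i ∈ Finset.range n, excessLoss D (x i, e i)
          + (n * (2 * b * (1 / n)) + 2 * (1 / n) * ∑ i ∈ Finset.range n, |e i|) := by
        rw [Finset.sum_add_distrib, Finset.sum_add_distrib, Finset.mul_sum, Finset.sum_const,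
          Finset.card_range, nsmul_eq_mul]
    _ ≤ 0 + (n * (2 * b * (1 / n)) + 2 * (1 / n) * (K * n)) := by gcongr
    _ = 2 * b + 2 * K := by
        field_simp
        ring

/-- If `f` is `ρ / 2`-close to `g` uniformly, and has `L²`-norm larger than `ρ`, then the
`L²`-norm of `g` is at least `ρ / 2`. -/
theorem sq_half_le_integral_sq_of_uniform_close {E : Type*} [MeasurableSpace E] {μ : Measure E}
    [IsProbabilityMeasure μ] {f g : E → ℝ} (hf : Measurable f) (hg : MemLp g 2 μ) {η ρ : ℝ}
    (hρ : 0 ≤ ρ) (hη : η ≤ ρ / 2) (hfg : ∀ᵐ x ∂μ, |f x - g x| ≤ η)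
    (h : ENNReal.ofReal ρ < eLpNorm f 2 μ) : (ρ / 2) ^ 2 ≤ ∫ x, g x ^ 2 ∂μ := by
  by_contra! hlt
  refine h.not_ge ?_
  have h1 : eLpNorm (f - g) 2 μ ≤ ENNReal.ofReal (ρ / 2) := by
    have := eLpNorm_le_of_ae_bound (μ := μ) (p := 2) (f := f - g) (C := ρ / 2)
      (by filter_upwards [hfg] with x hx using hx.trans hη)
    simpa using this
  have h2 : eLpNorm g 2 μ ≤ ENNReal.ofReal (ρ / 2) := by
    rw [eLpNorm_two_eq_ofReal_sqrt hg]
    exact ENNReal.ofReal_le_ofReal (Real.sqrt_le_iff.2 ⟨by positivity, hlt.le⟩)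
  calc eLpNorm f 2 μ = eLpNorm ((f - g) + g) 2 μ := by rw [sub_add_cancel]
    _ ≤ eLpNorm (f - g) 2 μ + eLpNorm g 2 μ :=
        eLpNorm_add_le (hf.aestronglyMeasurable.sub hg.1) hg.1 one_le_two
    _ ≤ ENNReal.ofReal (ρ / 2) + ENNReal.ofReal (ρ / 2) := add_le_add h1 h2
    _ = ENNReal.ofReal ρ := by
        rw [← ENNReal.ofReal_add (by positivity) (by positivity), add_halves]

theorem one_div_le_sqrt_log_div {n : ℕ} (hn : 2 ≤ n) : 1 / (n : ℝ) ≤ Real.sqrt (Real.log n / n) := by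
  have hn2 : (2 : ℝ) ≤ n := by exact_mod_cast hn
  have hlog : 1 / 2 ≤ Real.log n := by
    have := Real.log_le_log two_pos hn2
    linarith [Real.log_two_gt_d9]
  refine Real.le_sqrt_of_sq_le ?_
  rw [div_pow, one_pow, div_le_div_iff₀ (by positivity) (by positivity)]
  nlinarith

/-- Least squares over a uniformly bounded class with polynomial uniform covers, with Gaussian
noise, has the rate `√(log n / n)` in `L²(μ)`. -/
theorem isBigOP_leastSquares {E : Type*} [MeasurableSpace E] {𝒳 : Set E} {𝓕 : Set (E → ℝ)}
    (h_meas : ∀ f ∈ 𝓕, Measurable f) {B : ℝ} (hB : ∀ f ∈ 𝓕, ∀ x ∈ 𝒳, |f x| ≤ B)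
    (h_cover : HasPolynomialUniformCovers 𝒳 𝓕) {fstar : E → ℝ} (hfstar : fstar ∈ 𝓕)
    {μ : Measure E} [IsProbabilityMeasure μ] (hμ : ∀ᵐ x ∂μ, x ∈ 𝒳) {v : ℝ≥0}
    {Ω : Type*} [MeasurableSpace Ω] {P : Measure Ω} [IsProbabilityMeasure P]
    {X : ℕ → Ω → E} {Y noise : ℕ → Ω → ℝ}
    (hX : ∀ i, Measurable (X i)) (hnoise : ∀ i, Measurable (noise i))
    (h_indep : iIndepFun (fun i ω => (X i ω, noise i ω)) P)
    (h_law : ∀ i, P.map (fun ω => (X i ω, noise i ω)) = μ.prod (gaussianReal 0 v))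
    (hY : ∀ i, ∀ᵐ ω ∂P, Y i ω = fstar (X i ω) + noise i ω) {fhat : ℕ → Ω → E → ℝ}
    (hfhat : ∀ n, ∀ᵐ ω ∂P, fhat n ω ∈ 𝓕 ∧
      ∑ i ∈ Finset.range n, (Y i ω - fhat n ω (X i ω)) ^ 2 ≤
        ∑ i ∈ Finset.range n, (Y i ω - fstar (X i ω)) ^ 2) :
    IsBigOP P (fun n ω => eLpNorm (fun x => fhat n ω x - fstar x) 2 μ)
      (fun n => Real.sqrt (Real.log n / n)) := by
  classical
  have hZ : ∀ i, Measurable (fun ω => (X i ω, noise i ω)) := fun i => (hX i).prodMk (hnoise i)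
  have hX_law : ∀ i, P.map (X i) = μ := fun i => by
    have := congrArg (Measure.map Prod.fst) (h_law i)
    rwa [Measure.map_map measurable_fst (hZ i), Measure.map_fst_prod, measure_univ, one_smul]
      at this
  have hnoise_law : ∀ i, P.map (noise i) = gaussianReal 0 v := fun i => by
    have := congrArg (Measure.map Prod.snd) (h_law i)
    rwa [Measure.map_map measurable_snd (hZ i), Measure.map_snd_prod, measure_univ, one_smul]
      at this
  have hX𝒳 : ∀ᵐ ω ∂P, ∀ i, X i ω ∈ 𝒳 := ae_all_iff.2 fun i => by
    have : ∀ᵐ x ∂(P.map (X i)), x ∈ 𝒳 := by rwa [hX_law i]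
    exact ae_of_ae_map (hX i).aemeasurable this
  have h_id : Integrable (fun e : ℝ => e) (gaussianReal 0 v) :=
    memLp_one_iff_integrable.1 (by exact_mod_cast memLp_id_gaussianReal (μ := 0) (v := v) 1)
  have hnoise_int : ∀ i, Integrable (noise i) P := fun i => by
    rw [← hnoise_law i] at h_id
    exact h_id.comp_measurable (hnoise i)
  set κ := ∫ e, |e| ∂(gaussianReal 0 v) with hκ
  have hκ0 : 0 ≤ κ := integral_nonneg fun _ => abs_nonneg _
  have hnoise_abs : ∀ i, ∫ ω, |noise i ω| ∂P = κ := fun i => by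
    rw [hκ, ← hnoise_law i, integral_map (hnoise i).aemeasurable
      continuous_abs.aestronglyMeasurable]
  obtain ⟨C, p, h_cover⟩ := h_cover
  set b := 2 * B with hb
  have hdiff : ∀ f ∈ 𝓕, ∀ x ∈ 𝒳, |f x - fstar x| ≤ b := fun f hf x hx =>
    (abs_sub _ _).trans (by linarith [hB f hf x hx, hB _ hfstar x hx])
  -- One `l` small enough for both the variance condition and the boundedness condition of the
  -- exponential moment bound.
  set l : ℝ := 1 / (4 * v + b ^ 2 + 1) with hl
  have hden : 0 < 4 * (v : ℝ) + b ^ 2 + 1 := by positivity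
  have hl0 : 0 < l := by positivity
  have hlv : l * v ≤ 1 / 4 := by
    rw [hl, div_mul_eq_mul_div, div_le_div_iff₀ hden (by norm_num)]
    nlinarith [sq_nonneg b]
  have hlb : l / 2 * b ^ 2 ≤ 1 := by
    rw [hl, div_div, div_mul_eq_mul_div, div_le_one (by positivity)]
    nlinarith [sq_nonneg b, v.coe_nonneg]
  intro δ hδ
  -- Markov's inequality then gives `δ / 2`; the `+ 1` keeps `K` positive for degenerate noise.
  set K := 2 * κ / δ + 1 with hK
  have hK0 : 0 < K := by positivity
  have hKδ : κ ≤ K * (δ / 2) := by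
    rw [hK]
    field_simp
    linarith
  set t := 2 * b + 2 * K with ht
  -- The factor `l / 16` comes from `n (l / 4) (M r / 2)² = (l / 16) M² log n`.
  obtain ⟨M, hM2, hM⟩ := exists_rate_constant (C * Real.exp (l * t)) p (l / 16)
    (Nat.cast_nonneg p) (by positivity) (half_pos hδ)
  refine ⟨M, by linarith, fun n hn => ?_⟩
  have hn2 : 2 ≤ n := by
    by_contra! h
    interval_cases n <;> simp at hn
  have hn1 : 1 ≤ n := by omega
  have hn0 : (0 : ℝ) < n := by exact_mod_cast hn1
  set r := Real.sqrt (Real.log n / n) with hr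
  obtain ⟨T, hTF, hTc, hT⟩ := h_cover n hn1
  -- Only these `g` can be `1 / n`-close to an estimator with error above `M r`, because `1 / n ≤ r
  -- ≤ M r / 2`.
  set T' := T.filter fun g => (M * r / 2) ^ 2 ≤ ∫ x, (g x - fstar x) ^ 2 ∂μ with hT'
  have hDb : ∀ g ∈ 𝓕, ∀ᵐ x ∂μ, |g x - fstar x| ≤ b := fun g hg => by
    filter_upwards [hμ] with x hx using hdiff g hg x hx
  set S₁ : Set Ω := {ω | K * n ≤ ∑ i ∈ Finset.range n, |noise i ω|} with hS₁
  set S₂ : (E → ℝ) → Set Ω := fun g =>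
    {ω | ∑ i ∈ Finset.range n, excessLoss (fun x => g x - fstar x) (X i ω, noise i ω) ≤ t}
    with hS₂
  -- An inclusion up to a null set bounds the outer probability, so `fhat` need not be measurable in
  -- `ω`.
  have h_subset : ∀ᵐ ω ∂P,
      ENNReal.ofReal (M * r) < eLpNorm (fun x => fhat n ω x - fstar x) 2 μ →
        ω ∈ S₁ ∪ ⋃ g ∈ T', S₂ g := by
    filter_upwards [hX𝒳, ae_all_iff.2 hY, hfhat n] with ω hω hYω hfω hlt
    obtain ⟨hfF, hfle⟩ := hfω
    rcases le_total (K * n) (∑ i ∈ Finset.range n, |noise i ω|) with hS | hS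
    · exact Or.inl hS
    refine Or.inr ?_
    obtain ⟨g, hgT, hg⟩ := hT _ hfF
    have hgF : g ∈ 𝓕 := hTF hgT
    simp only [Set.mem_iUnion]
    refine ⟨g, Finset.mem_filter.2 ⟨hgT, ?_⟩, ?_⟩
    · refine sq_half_le_integral_sq_of_uniform_close (η := 1 / n)
        ((h_meas _ hfF).sub (h_meas _ hfstar)) ?_ (by positivity) ?_ ?_ hlt
      · exact MemLp.of_bound ((h_meas _ hgF).sub (h_meas _ hfstar)).aestronglyMeasurable b
          (hDb g hgF)
      · nlinarith [one_div_le_sqrt_log_div hn2]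
      · filter_upwards [hμ] with x hx
        simp only [Pi.sub_apply, sub_sub_sub_cancel_right]
        exact hg x hx
    · refine sum_excessLoss_le_of_uniform_close (x := fun i => X i ω) (e := fun i => noise i ω)
        (D := fun x => fhat n ω x - fstar x) (D' := fun x => g x - fstar x) hn1
        (fun i => hdiff _ hfF _ (hω i)) (fun i => hdiff _ hgF _ (hω i)) (fun i => ?_) hS
        (sum_excessLoss_nonpos_of_sum_sq_le hYω hfle)
      simp only [sub_sub_sub_cancel_right]
      exact hg _ (hω i)
  have hP₁ : P.real S₁ ≤ δ / 2 := measureReal_sum_abs_ge_le hnoise_int hnoise_abs hn1 hK0 hKδ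
  have hP₂ : ∀ g ∈ T', P.real (S₂ g) ≤
      Real.exp (l * t) * Real.exp (-(l / 16 * M ^ 2 * Real.log n)) := by
    intro g hg
    obtain ⟨hgT, hgL⟩ := Finset.mem_filter.1 hg
    have hgF : g ∈ 𝓕 := hTF hgT
    refine (measureReal_sum_excessLoss_le hZ h_indep h_law
      ((h_meas _ hgF).sub (h_meas _ hfstar)) (hDb g hgF) hl0.le hlv hlb n t).trans ?_
    rw [← Real.exp_add, Real.exp_le_exp]
    have hr2 : r ^ 2 = Real.log n / n :=
      Real.sq_sqrt (div_nonneg (Real.log_natCast_nonneg n) hn0.le)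
    have : l / 16 * M ^ 2 * Real.log n = n * (l / 4 * (M * r / 2) ^ 2) := by
      rw [div_pow, mul_pow, hr2]
      field_simp
      ring
    rw [this, ← sub_eq_add_neg]
    gcongr
    exact hgL
  have hP₂' : P.real (⋃ g ∈ T', S₂ g) ≤ δ / 2 := by
    calc P.real (⋃ g ∈ T', S₂ g) ≤ ∑ g ∈ T', P.real (S₂ g) := measureReal_biUnion_finset_le _ _
      _ ≤ T'.card • (Real.exp (l * t) * Real.exp (-(l / 16 * M ^ 2 * Real.log n))) :=
          Finset.sum_le_card_nsmul _ _ _ hP₂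
      _ ≤ (C * (n : ℝ) ^ (p : ℝ)) *
            (Real.exp (l * t) * Real.exp (-(l / 16 * M ^ 2 * Real.log n))) := by
          rw [nsmul_eq_mul, Real.rpow_natCast]
          gcongr
          exact_mod_cast (Finset.card_filter_le _ _).trans hTc
      _ = C * Real.exp (l * t) * (n : ℝ) ^ (p : ℝ) *
            Real.exp (-(l / 16 * M ^ 2 * Real.log n)) := by ring
      _ ≤ δ / 2 := hM n hn2
  calc P {ω | ENNReal.ofReal (M * r) < eLpNorm (fun x => fhat n ω x - fstar x) 2 μ}
      ≤ P (S₁ ∪ ⋃ g ∈ T', S₂ g) := measure_mono_ae h_subset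
    _ = ENNReal.ofReal (P.real (S₁ ∪ ⋃ g ∈ T', S₂ g)) := by simp
    _ ≤ ENNReal.ofReal δ := by
        refine ENNReal.ofReal_le_ofReal ((measureReal_union_le _ _).trans ?_)
        linarith

/-! ### Covers for the cosine router -/

section CosineRouter

variable {d₁ d₂ : ℕ}

/-- Replace the gating vector `β₁` by its direction `β₁ / ‖β₁‖` (`0` if `β₁ = 0`), on which the
cosine score depends linearly. -/
noncomputable def normalizeGate (θ : ExpertParam d₁ d₂) : ExpertParam d₁ d₂ :=
  (θ.1, ‖θ.2.1‖⁻¹ • θ.2.1, θ.2.2)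

theorem norm_inv_norm_smul_le_one {F : Type*} [NormedAddCommGroup F] [NormedSpace ℝ F] (x : F) :
    ‖‖x‖⁻¹ • x‖ ≤ 1 := by
  rw [norm_smul, norm_inv, norm_norm]
  exact inv_mul_le_one

/-- Normalization is discontinuous at `β₁ = 0`, so compactness may be lost; boundedness survives and
is all that the covers need. -/
theorem isBounded_image_normalizeGate {Θ : Set (ExpertParam d₁ d₂)} (hΘ : IsCompact Θ) :
    Bornology.IsBounded (normalizeGate '' Θ) := by
  obtain ⟨R, hR⟩ := hΘ.isBounded.exists_norm_le
  rw [isBounded_iff_forall_norm_le]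
  refine ⟨max R 1, ?_⟩
  rintro _ ⟨θ, hθ, rfl⟩
  have h1 : ‖θ.1‖ ≤ R := (norm_fst_le θ).trans (hR θ hθ)
  have h2 : ‖θ.2.2‖ ≤ R := (norm_snd_le θ.2).trans ((norm_snd_le θ).trans (hR θ hθ))
  exact norm_prod_le_iff.2 ⟨h1.trans (le_max_left _ _), norm_prod_le_iff.2
    ⟨(norm_inv_norm_smul_le_one _).trans (le_max_right _ _), h2.trans (le_max_left _ _)⟩⟩

theorem cosScore_eq_inner (β x : RVec d₁) :
    cosScore β x = inner ℝ (‖β‖⁻¹ • β) (‖x‖⁻¹ • x) := by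
  rw [real_inner_smul_left, real_inner_smul_right, cosScore, div_eq_mul_inv, mul_inv]
  ring

/-- The regression function in terms of normalized parameters. -/
noncomputable def normalizedRegression (h : RVec d₁ → RVec d₂ → ℝ) {k : ℕ}
    (φ : Fin k → ExpertParam d₁ d₂) (x : RVec d₁) : ℝ :=
  ∑ i, softmaxWeight (fun j => inner ℝ (φ j).2.1 (‖x‖⁻¹ • x) + (φ j).1) i * h x (φ i).2.2

theorem moeRegression_eq_normalizedRegression (h : RVec d₁ → RVec d₂ → ℝ) {k : ℕ}
    (θ : Fin k → ExpertParam d₁ d₂) :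
    moeRegression h (mixingMeasure θ) = normalizedRegression h fun i => normalizeGate (θ i) := by
  ext x
  rw [moeRegression_mixingMeasure]
  simp only [cosScore_eq_inner]
  rfl

theorem measurable_moeRegression_mixingMeasure {h : RVec d₁ → RVec d₂ → ℝ} {k : ℕ}
    {θ : Fin k → ExpertParam d₁ d₂} (hh : ∀ i, Measurable fun x => h x (θ i).2.2) :
    Measurable (moeRegression h (mixingMeasure θ)) := by
  have : ∀ j, Measurable fun x => cosScore (θ j).2.1 x := fun j => by
    unfold cosScore
    fun_prop
  have e : moeRegression h (mixingMeasure θ) = fun x =>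
      ∑ i, softmaxWeight (fun j => cosScore (θ j).2.1 x + (θ j).1) i * h x (θ i).2.2 :=
    funext fun x => moeRegression_mixingMeasure h θ x
  rw [e]
  unfold softmaxWeight
  fun_prop

variable {𝒳 : Set (RVec d₁)} {Θ : Set (ExpertParam d₁ d₂)} {h : RVec d₁ → RVec d₂ → ℝ}

theorem mem_expertParams {θ : ExpertParam d₁ d₂} (hθ : θ ∈ Θ) : θ.2.2 ∈ expertParams Θ :=
  ⟨θ, hθ, rfl⟩

theorem abs_normalizedRegression_sub_le {L : ℝ≥0}
    (h_lip : ∀ x ∈ 𝒳, LipschitzOnWith L (h x) (expertParams Θ)) {B : ℝ} (hB : 0 ≤ B)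
    (h_bdd : ∀ x ∈ 𝒳, ∀ η ∈ expertParams Θ, |h x η| ≤ B) {k : ℕ}
    {φ ψ : Fin k → ExpertParam d₁ d₂} (hφ : ∀ i, (φ i).2.2 ∈ expertParams Θ)
    (hψ : ∀ i, (ψ i).2.2 ∈ expertParams Θ) {x : RVec d₁} (hx : x ∈ 𝒳) :
    |normalizedRegression h φ x - normalizedRegression h ψ x| ≤ (L + 8 * B) * dist φ ψ := by
  have hi : ∀ i, dist (φ i) (ψ i) ≤ dist φ ψ := dist_le_pi_dist φ ψ
  have h1 : ∀ i, |(φ i).1 - (ψ i).1| ≤ dist φ ψ := fun i =>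
    (le_max_left _ _).trans (hi i)
  have h2 : ∀ i, dist (φ i).2.1 (ψ i).2.1 ≤ dist φ ψ := fun i =>
    ((le_max_left _ _).trans (le_max_right _ _)).trans (hi i)
  have h3 : ∀ i, dist (φ i).2.2 (ψ i).2.2 ≤ dist φ ψ := fun i =>
    ((le_max_right _ _).trans (le_max_right _ _)).trans (hi i)
  have key := abs_sum_softmaxWeight_mul_sub_le
    (v := fun j => inner ℝ (φ j).2.1 (‖x‖⁻¹ • x) + (φ j).1)
    (w := fun j => inner ℝ (ψ j).2.1 (‖x‖⁻¹ • x) + (ψ j).1)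
    (a := fun i => h x (φ i).2.2) (c := fun i => h x (ψ i).2.2)
    -- A score moves by at most `dist φ ψ` through the direction and as much through the bias; `4 *
    -- ε * B` then gives the `8 * B`.
    (ε := 2 * dist φ ψ) (δ := L * dist φ ψ) hB (by positivity) (by positivity)
    (fun i => ?_) (fun i => ?_) (fun i => h_bdd x hx _ (hψ i))
  · refine key.trans (le_of_eq ?_)
    ring
  · rw [add_sub_add_comm, ← inner_sub_left, two_mul]
    refine (abs_add_le _ _).trans (add_le_add ?_ (h1 i))
    calc |inner ℝ ((φ i).2.1 - (ψ i).2.1) (‖x‖⁻¹ • x)|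
        ≤ ‖(φ i).2.1 - (ψ i).2.1‖ * ‖‖x‖⁻¹ • x‖ := abs_real_inner_le_norm _ _
      _ ≤ dist φ ψ * 1 := by
          gcongr
          · rw [← dist_eq_norm]
            exact h2 i
          · exact norm_inv_norm_smul_le_one x
      _ = dist φ ψ := mul_one _
  · calc |h x (φ i).2.2 - h x (ψ i).2.2| ≤ L * dist (φ i).2.2 (ψ i).2.2 :=
          (h_lip x hx).dist_le_mul _ (hφ i) _ (hψ i)
      _ ≤ L * dist φ ψ := by
          gcongr
          exact h3 i

theorem moeRegression_image_exactMixing (h : RVec d₁ → RVec d₂ → ℝ) (Θ : Set (ExpertParam d₁ d₂))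
    (k : ℕ) : moeRegression h '' exactMixing Θ k =
      normalizedRegression h '' Set.univ.pi fun _ : Fin k => normalizeGate '' Θ := by
  ext f
  constructor
  · rintro ⟨_, ⟨θ, hθ, rfl⟩, rfl⟩
    exact ⟨_, fun i _ => Set.mem_image_of_mem _ (hθ i),
      (moeRegression_eq_normalizedRegression h θ).symm⟩
  · rintro ⟨φ, hφ, rfl⟩
    choose θ hθ hθφ using fun i => hφ i (Set.mem_univ i)
    refine ⟨mixingMeasure θ, ⟨θ, hθ, rfl⟩, ?_⟩
    rw [moeRegression_eq_normalizedRegression]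
    exact congrArg _ (funext hθφ)

theorem hasPolynomialUniformCovers_exactMixing (hΘ : IsCompact Θ) {L : ℝ≥0}
    (h_lip : ∀ x ∈ 𝒳, LipschitzOnWith L (h x) (expertParams Θ)) {B : ℝ} (hB : 0 ≤ B)
    (h_bdd : ∀ x ∈ 𝒳, ∀ η ∈ expertParams Θ, |h x η| ≤ B) (k : ℕ) :
    HasPolynomialUniformCovers 𝒳 (moeRegression h '' exactMixing Θ k) := by
  rw [moeRegression_image_exactMixing]
  have hmem : ∀ φ ∈ Set.univ.pi fun _ : Fin k => normalizeGate '' Θ,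
      ∀ i, (φ i).2.2 ∈ expertParams Θ := fun φ hφ i => by
    obtain ⟨θ, hθ, e⟩ := hφ i (Set.mem_univ i)
    rw [← e]
    exact ⟨θ, hθ, rfl⟩
  exact HasPolynomialUniformCovers.image
    (Bornology.IsBounded.pi fun _ => isBounded_image_normalizeGate hΘ) _ (L + 8 * B)
    fun φ hφ ψ hψ x hx =>
      abs_normalizedRegression_sub_le h_lip hB h_bdd (hmem φ hφ) (hmem ψ hψ) hx

theorem overMixing_succ (Θ : Set (ExpertParam d₁ d₂)) (k : ℕ) :
    overMixing Θ (k + 1) = overMixing Θ k ∪ exactMixing Θ (k + 1) := by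
  ext G
  constructor
  · rintro ⟨k', h1, h2, hG⟩
    rcases Nat.le_succ_iff.1 h2 with h3 | rfl
    · exact Or.inl ⟨k', h1, h3, hG⟩
    · exact Or.inr hG
  · rintro (⟨k', h1, h2, hG⟩ | hG)
    · exact ⟨k', h1, h2.trans k.le_succ, hG⟩
    · exact ⟨k + 1, k.succ_pos, le_rfl, hG⟩

theorem hasPolynomialUniformCovers_overMixing (hΘ : IsCompact Θ) {L : ℝ≥0}
    (h_lip : ∀ x ∈ 𝒳, LipschitzOnWith L (h x) (expertParams Θ)) {B : ℝ} (hB : 0 ≤ B)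
    (h_bdd : ∀ x ∈ 𝒳, ∀ η ∈ expertParams Θ, |h x η| ≤ B) (k : ℕ) :
    HasPolynomialUniformCovers 𝒳 (moeRegression h '' overMixing Θ k) := by
  induction k with
  | zero =>
    have : overMixing Θ 0 = ∅ := Set.eq_empty_of_forall_notMem
      fun _ ⟨_, h1, h2, _⟩ => absurd (h1.trans h2) (by simp)
    rw [this, Set.image_empty]
    exact .empty 𝒳
  | succ k ih =>
    rw [overMixing_succ, Set.image_union]
    exact ih.union (hasPolynomialUniformCovers_exactMixing hΘ h_lip hB h_bdd _)

end CosineRouter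

theorem theorem1 {d₁ d₂ : ℕ}
    -- input space, parameter space, expert function
    (𝒳 : Set (RVec d₁)) (h𝒳 : Bornology.IsBounded 𝒳)
    (Θ : Set (ExpertParam d₁ d₂)) (hΘ : IsCompact Θ)
    (h : RVec d₁ → RVec d₂ → ℝ)
    (h_meas : ∀ η ∈ expertParams Θ, Measurable (fun x => h x η))
    (h_lip : ∃ L : ℝ≥0, ∀ x ∈ 𝒳, LipschitzOnWith L (h x) (expertParams Θ))
    (h_bdd : ∃ B : ℝ, ∀ x ∈ 𝒳, ∀ η ∈ expertParams Θ, |h x η| ≤ B)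
    -- the true mixing measure
    (kstar : ℕ) (hkstar : 1 ≤ kstar)
    (Gstar : Measure (RVec d₁ × RVec d₂)) (hGstar : Gstar ∈ exactMixing Θ kstar)
    -- the law of the inputs, and the i.i.d. sample with Gaussian noise
    (μ : Measure (RVec d₁)) [IsProbabilityMeasure μ] (hμ : ∀ᵐ x ∂μ, x ∈ 𝒳)
    (σ : ℝ≥0)
    {Ω : Type*} [MeasurableSpace Ω] (P : Measure Ω) [IsProbabilityMeasure P]
    (X : ℕ → Ω → RVec d₁) (Y noise : ℕ → Ω → ℝ)
    (hX : ∀ i, Measurable (X i)) (hnoise : ∀ i, Measurable (noise i))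
    (h_indep : iIndepFun (fun i ω => (X i ω, noise i ω)) P)
    (h_law : ∀ i, P.map (fun ω => (X i ω, noise i ω)) = μ.prod (gaussianReal 0 (σ ^ 2)))
    (hY : ∀ i, ∀ᵐ ω ∂P, Y i ω = moeRegression h Gstar (X i ω) + noise i ω) :
    -- exact-specified setting: minimization over `𝓔_{k_*}(Θ)`
    (∀ Ghat : ℕ → Ω → Measure (RVec d₁ × RVec d₂),
      (∀ n, ∀ᵐ ω ∂P, IsLeastSquares h (exactMixing Θ kstar)
        (fun i => X i ω) (fun i => Y i ω) n (Ghat n ω)) →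
      IsBigOP P
        (fun n ω => eLpNorm (fun x => moeRegression h (Ghat n ω) x - moeRegression h Gstar x) 2 μ)
        (fun n => Real.sqrt (Real.log n / n))) ∧
    -- over-specified setting: minimization over `𝓖_k(Θ)` for some `k > k_*`
    (∀ k : ℕ, kstar < k → ∀ Ghat : ℕ → Ω → Measure (RVec d₁ × RVec d₂),
      (∀ n, ∀ᵐ ω ∂P, IsLeastSquares h (overMixing Θ k)
        (fun i => X i ω) (fun i => Y i ω) n (Ghat n ω)) →
      IsBigOP P
        (fun n ω => eLpNorm (fun x => moeRegression h (Ghat n ω) x - moeRegression h Gstar x) 2 μ)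
        (fun n => Real.sqrt (Real.log n / n))) := by
  obtain ⟨L, hL⟩ := h_lip
  obtain ⟨B, hB⟩ := h_bdd
  have hB' : ∀ x ∈ 𝒳, ∀ η ∈ expertParams Θ, |h x η| ≤ |B| := fun x hx η hη =>
    (hB x hx η hη).trans (le_abs_self B)
  -- Both settings are instances; the number of experts may vary within `𝒢`.
  have main : ∀ 𝒢 : Set (Measure (RVec d₁ × RVec d₂)), (∀ G ∈ 𝒢, ∃ k, G ∈ exactMixing Θ k) →
      HasPolynomialUniformCovers 𝒳 (moeRegression h '' 𝒢) → Gstar ∈ 𝒢 →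
      ∀ Ghat : ℕ → Ω → Measure (RVec d₁ × RVec d₂),
      (∀ n, ∀ᵐ ω ∂P, IsLeastSquares h 𝒢 (fun i => X i ω) (fun i => Y i ω) n (Ghat n ω)) →
      IsBigOP P
        (fun n ω => eLpNorm (fun x => moeRegression h (Ghat n ω) x - moeRegression h Gstar x) 2 μ)
        (fun n => Real.sqrt (Real.log n / n)) := by
    intro 𝒢 h𝒢 hcov hG Ghat hGhat
    refine isBigOP_leastSquares (𝓕 := moeRegression h '' 𝒢) (B := |B|) ?_ ?_ hcov
      (Set.mem_image_of_mem _ hG) hμ hX hnoise h_indep h_law hY fun n => ?_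
    · rintro _ ⟨G, hG, rfl⟩
      obtain ⟨k, θ, hθ, rfl⟩ := h𝒢 G hG
      exact measurable_moeRegression_mixingMeasure fun i => h_meas _ (mem_expertParams (hθ i))
    · rintro _ ⟨G, hG, rfl⟩ x hx
      obtain ⟨k, θ, hθ, rfl⟩ := h𝒢 G hG
      rw [moeRegression_mixingMeasure]
      exact abs_sum_softmaxWeight_mul_le _ (abs_nonneg B)
        fun i => hB' x hx _ (mem_expertParams (hθ i))
    · filter_upwards [hGhat n] with ω hω
      exact ⟨Set.mem_image_of_mem _ hω.1, hω.2 Gstar hG⟩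
  refine ⟨main _ (fun G hG => ⟨_, hG⟩)
    (hasPolynomialUniformCovers_exactMixing hΘ hL (abs_nonneg B) hB' kstar) hGstar,
    fun k hk => main _ (fun G ⟨k', _, _, hG⟩ => ⟨k', hG⟩)
    (hasPolynomialUniformCovers_overMixing hΘ hL (abs_nonneg B) hB' k)
    ⟨kstar, hkstar, hk.le, hGstar⟩⟩
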